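/- **Definitions.** Let $I\subseteq\mathbb R$ be an interval. For $n\ge 1$ put $W_n=\{\lambda\in[0,\infty)^n:\lambda_1+\dots+\lambda_n>0\}$, $W_n^0=\{\lambda\in[0,\infty)^n:\lambda_1>0\}$, and let $V_n(\mathbb R)$ be the set of all $\lambda\in W_n^0$ for which $\big(\lambda_i/(\lambda_1+\dots+\lambda_i)\big)_{i=1}^n$ is nonincreasing. A *weighted mean* on $I$ is a function $M:\bigcup_{n\ge1}I^n\times W_n\to I$ such that for all $n\ge1$, $x\in I^n$ and $\lambda,\mu\in W_n$: (i) $M(x,t\lambda)=M(x,\lambda)$ for all $t>0$; (ii) $M(x,\lambda+\mu)=M\big((x_1,x_1,\dots,x_n,x_n),(\lambda_1,\mu_1,\dots,\lambda_n,\mu_n)\big)$; (iii) $\min_i x_i\le M(x,\lambda)\le\max_i x_i$; (iv) if $\lambda_j=0$, then $M(x,\lambda)$ does not change when the $j$-th entry and the $j$-th weight are deleted. It is *symmetric* if $M(x\circ\sigma,\lambda\circ\sigma)=M(x,\lambda)$ for all permutations $\sigma$ of $\{1,\dots,n\}$; *Jensen concave* if $M\big(\tfrac{x+y}2,\lambda\big)\ge\tfrac12\big(M(x,\lambda)+M(y,\lambda)\big)$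 for all $n\ge1$, $x,y\in I^n$, $\lambda\in W_n$; *continuous in the weights* if $\lambda\mapsto M(x,\lambda)$ is continuous on $W_n$ for all $n\ge1$ and $x\in I^n$. Let $A(x,\lambda)=\frac{\lambda_1x_1+\dots+\lambda_nx_n}{\lambda_1+\dots+\lambda_n}$. For $\lambda\in W_n^0$, $M$ satisfies the *$(n,\lambda)$-Kedlaya inequality* if for all $x\in I^n$ $$A\big((m_1,\dots,m_n),\lambda\big)\le M\big((a_1,\dots,a_n),\lambda\big),$$ where $m_k=M\big((x_1,\dots,x_k),(\lambda_1,\dots,\lambda_k)\big)$ and $a_k=A\big((x_1,\dots,x_k),(\lambda_1,\dots,\lambda_k)\big)$. Let $WR_n$ be the set of all $\lambda\in W_n^0$ such that every symmetric, Jensen concave weighted mean on $I$ that is continuous in the weights satisfies the $(n,\lambda)$-Kedlaya inequality. **Proposition 4.6.** Let $I\subseteq\mathbb R$ be an interval and let $f:I\to\mathbb R$ be twice continuously differentiable (with one-sided derivatives at endpoints belonging to $I$) with $f'(x)\ne0$ for all $x\in I$. Suppose that either $f''$ is identically zero on $I$, or $f''$ is nowhere zero on $I$ and $f'/f''$ is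 convex and negative on $I$. Then the weighted quasi-arithmetic mean $$(x,\lambda)\mapsto f^{-1}\left(\frac{\lambda_1f(x_1)+\dots+\lambda_nf(x_n)}{\lambda_1+\dots+\lambda_n}\right)\qquad(n\ge1,\ x\in I^n,\ \lambda\in W_n)$$ on $I$ satisfies the $(n,\lambda)$-Kedlaya inequality for all $n\ge1$ and all $\lambda\in WR_n$, and in particular for all $n\ge1$ and all $\lambda\in V_n(\mathbb R)$. -/

import Mathlib

namespace Kedlaya

/-- The weight vectors `W_n(ℝ)`: nonnegative entries with positive sum. -/
def W (n : ℕ) : Set (Fin n → ℝ) :=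
  {lam | (∀ i, 0 ≤ lam i) ∧ 0 < ∑ i, lam i}

/-- The weight vectors `W⁰_n(ℝ)`: nonnegative entries, the first one positive. -/
def W0 (n : ℕ) : Set (Fin n → ℝ) :=
  {lam | (∀ i, 0 ≤ lam i) ∧ ∃ h : 0 < n, 0 < lam ⟨0, h⟩}

/-- The set `V_n(ℝ)`: those `lam` in `W⁰_n(ℝ)` for which the sequence
`lam_i / (lam_1 + ⋯ + lam_i)` is nonincreasing. -/
def V (n : ℕ) : Set (Fin n → ℝ) :=
  {lam | lam ∈ W0 n ∧ Antitone fun i : Fin n => lam i / ∑ j ∈ Finset.Iic i, lam j}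

/-- The shuffle `(p_1, q_1, …, p_n, q_n)` of two vectors. -/
def shuffle {n : ℕ} (p q : Fin n → ℝ) : Fin (2 * n) → ℝ := fun j =>
  if (j : ℕ) % 2 = 0 then p ⟨j / 2, by omega⟩ else q ⟨j / 2, by omega⟩

/-- Operations on pairs of an `n`-vector of entries and an `n`-vector of weights. A mean on `I` is
such an operation looked at only for entries in `I` and weights in `W n`; its other
values play no role in anything below. -/
abbrev MeanFun : Type := (n : ℕ) → (Fin n → ℝ) → (Fin n → ℝ) → ℝ

/-- `M` is an `ℝ`-weighted mean on `I`. (As `W 0` is empty, only `n ≥ 1` matters.) -/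
structure IsWeightedMean (I : Set ℝ) (M : MeanFun) : Prop where
  maps_to : ∀ (n : ℕ) (x lam : Fin n → ℝ), (∀ i, x i ∈ I) → lam ∈ W n → M n x lam ∈ I
  nullhomogeneous : ∀ (n : ℕ) (x lam : Fin n → ℝ) (t : ℝ), (∀ i, x i ∈ I) → lam ∈ W n → 0 < t →
    M n x lam = M n x (t • lam)
  reduction : ∀ (n : ℕ) (x lam mu : Fin n → ℝ), (∀ i, x i ∈ I) → lam ∈ W n → mu ∈ W n →
    M n x (lam + mu) = M (2 * n) (shuffle x x) (shuffle lam mu)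
  mean_value : ∀ (n : ℕ) (x lam : Fin n → ℝ), (∀ i, x i ∈ I) → lam ∈ W n →
    ⨅ i, x i ≤ M n x lam ∧ M n x lam ≤ ⨆ i, x i
  elimination : ∀ (n : ℕ) (x lam : Fin (n + 1) → ℝ) (j : Fin (n + 1)), (∀ i, x i ∈ I) →
    lam ∈ W (n + 1) → lam j = 0 →
    M (n + 1) x lam = M n (fun i => x (j.succAbove i)) (fun i => lam (j.succAbove i))

/-- Symmetry of a weighted mean on `I`. -/
def IsSymmetric (I : Set ℝ) (M : MeanFun) : Prop :=
  ∀ (n : ℕ) (x lam : Fin n → ℝ) (σ : Equiv.Perm (Fin n)), (∀ i, x i ∈ I) → lam ∈ W n →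
    M n x lam = M n (x ∘ σ) (lam ∘ σ)

/-- Jensen concavity of a weighted mean on `I`. -/
def IsJensenConcave (I : Set ℝ) (M : MeanFun) : Prop :=
  ∀ (n : ℕ) (x y lam : Fin n → ℝ), (∀ i, x i ∈ I) → (∀ i, y i ∈ I) → lam ∈ W n →
    (M n x lam + M n y lam) / 2 ≤ M n (fun i => (x i + y i) / 2) lam

/-- Continuity in the weights of a weighted mean on `I`. -/
def IsContinuousInWeights (I : Set ℝ) (M : MeanFun) : Prop :=
  ∀ (n : ℕ) (x : Fin n → ℝ), (∀ i, x i ∈ I) → ContinuousOn (fun lam => M n x lam) (W n)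

/-- The weighted arithmetic mean. -/
noncomputable def arith : MeanFun := fun _ x lam => (∑ i, lam i * x i) / ∑ i, lam i

/-- The vector of the entries of `x` with (zero-based) indices `0, …, k`, of length `k + 1`. -/
def initial {n : ℕ} (x : Fin n → ℝ) (k : Fin n) : Fin ((k : ℕ) + 1) → ℝ :=
  fun i => x (Fin.castLE k.isLt i)

/-- The `(n, lam)`-Kedlaya inequality for the mean `M` on `I`. -/
def SatisfiesKedlaya (I : Set ℝ) (M : MeanFun) (n : ℕ) (lam : Fin n → ℝ) : Prop :=
  ∀ x : Fin n → ℝ, (∀ i, x i ∈ I) →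
    arith n (fun k => M (k + 1) (initial x k) (initial lam k)) lam ≤
      M n (fun k => arith (k + 1) (initial x k) (initial lam k)) lam

/-- The set `WR_n`, with the domain `I` of the means made explicit: all `lam` in `W⁰_n(ℝ)` such that
every symmetric and Jensen concave `ℝ`-weighted mean on `I` which is continuous in the weights
satisfies the `(n, lam)`-Kedlaya inequality. For each interval `I` it contains the set obtained by
quantifying over the means on all intervals at once. -/
def WR (I : Set ℝ) (n : ℕ) : Set (Fin n → ℝ) :=
  {lam | lam ∈ W0 n ∧ ∀ M : MeanFun, IsWeightedMean I M → IsSymmetric I M → IsJensenConcave I M →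
    IsContinuousInWeights I M → SatisfiesKedlaya I M n lam}

/-- The weighted quasi-arithmetic mean generated by `f` on `I`:
the inverse of `f` restricted to `I`, at the weighted arithmetic mean of the `f (x i)`. -/
noncomputable def quasiArith (I : Set ℝ) (f : ℝ → ℝ) : MeanFun := fun _ x lam =>
  Function.invFunOn f I ((∑ i, lam i * f (x i)) / ∑ i, lam i)

end Kedlaya

/-! Replacing `f` by `-f` changes no mean, so assume `f' > 0`; then `f'' ≤ 0`. The central fact is
that the mean is concave in its entries (`finsetMean_concave`). Along a segment the mean is `f⁻¹ ∘
N`, with `N` the weighted average of the values of `f`, and the sign of its second derivative is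
settled by Cauchy–Schwarz and Jensen's inequality for `-f'² / f''` read as a function of `f`. That
function is concave because its slope in the variable `f` is formally `g' - 1`, where `g = -f' /
f''` is concave. If `f'' = 0`, the estimate is immediate.

For `WR I n` the claim then follows from the definition, the remaining axioms being direct.

For `V n` no inclusion in `WR I n` is used. The inequality is proved by induction on the length
(`average_finsetMean_le`): with `S` the old total weight and `l` the new weight, each arithmetic
mean is `a j = (S * b j + l * x j) / (S + l)`, where `b j` lies between `a j` and `a (j - 1)`.
Concavity of the mean separates the `x` part from the `b` part, and concavity of `f` with a
telescoping sum bounds the mean of the `b j` below by the previous mean of the `a j`. -/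

namespace Kedlaya

/-- A generator `f` on `I`, increasing, with derivatives `f₁ = f'` and `f₂ = f''`, such that either
`f''` vanishes identically or `f''` is negative and `f' / f''` is convex. -/
structure IsGenerator (I : Set ℝ) (f f₁ f₂ : ℝ → ℝ) : Prop where
  ordConnected : I.OrdConnected
  hasDeriv : ∀ x ∈ I, HasDerivWithinAt f (f₁ x) I x
  hasDeriv₂ : ∀ x ∈ I, HasDerivWithinAt f₁ (f₂ x) I x
  pos : ∀ x ∈ I, 0 < f₁ x
  curvature : (∀ x ∈ I, f₂ x = 0) ∨
    ((∀ x ∈ I, f₂ x < 0) ∧ ConvexOn ℝ I fun x => f₁ x / f₂ x)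

/-- The quasi-arithmetic mean generated by `f` on `I` of a finite family. -/
noncomputable def finsetMean {ι : Type*} (I : Set ℝ) (f : ℝ → ℝ) (s : Finset ι) (w x : ι → ℝ) : ℝ :=
  Function.invFunOn f I ((∑ i ∈ s, w i * f (x i)) / ∑ i ∈ s, w i)

/-! ### Generators and their inverses -/

namespace IsGenerator

variable {I : Set ℝ} {f f₁ f₂ : ℝ → ℝ}

theorem convex (h : IsGenerator I f f₁ f₂) : Convex ℝ I := h.ordConnected.convex

theorem continuousOn (h : IsGenerator I f f₁ f₂) : ContinuousOn f I :=
  fun x hx => (h.hasDeriv x hx).continuousWithinAt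

theorem nonpos (h : IsGenerator I f f₁ f₂) : ∀ x ∈ I, f₂ x ≤ 0 := by
  intro x hx
  rcases h.curvature with h0 | ⟨h0, -⟩
  · exact (h0 x hx).le
  · exact (h0 x hx).le

theorem strictMonoOn (h : IsGenerator I f f₁ f₂) : StrictMonoOn f I :=
  strictMonoOn_of_hasDerivWithinAt_pos h.convex h.continuousOn
    (fun x hx => (h.hasDeriv x (interior_subset hx)).mono interior_subset)
    fun x hx => h.pos x (interior_subset hx)

theorem concaveOn (h : IsGenerator I f f₁ f₂) : ConcaveOn ℝ I f :=
  concaveOn_of_hasDerivWithinAt2_nonpos h.convex h.continuousOn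
    (fun x hx => (h.hasDeriv x (interior_subset hx)).mono interior_subset)
    (fun x hx => (h.hasDeriv₂ x (interior_subset hx)).mono interior_subset)
    fun x hx => h.nonpos x (interior_subset hx)

theorem ordConnected_image (h : IsGenerator I f f₁ f₂) : (f '' I).OrdConnected :=
  (h.ordConnected.isPreconnected.image f h.continuousOn).ordConnected

theorem invFunOn_apply (h : IsGenerator I f f₁ f₂) {x : ℝ} (hx : x ∈ I) :
    Function.invFunOn f I (f x) = x :=
  h.strictMonoOn.injOn (Function.invFunOn_mem ⟨x, hx, rfl⟩) hx
    (Function.invFunOn_eq ⟨x, hx, rfl⟩)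

theorem continuousOn_invFunOn (h : IsGenerator I f f₁ f₂) :
    ContinuousOn (Function.invFunOn f I) (f '' I) := by
  have := h.ordConnected
  have := h.ordConnected_image
  -- On order-connected sets the subspace topology is the order topology, so an order isomorphism is
  -- a homeomorphism.
  have hc := (h.strictMonoOn.orderIso f I).toHomeomorph.symm.continuous
  rw [continuousOn_iff_continuous_domRestrict]
  refine (continuous_subtype_val.comp hc).congr ?_
  rintro ⟨_, x, hx, rfl⟩
  have : (h.strictMonoOn.orderIso f I).symm ⟨f x, x, hx, rfl⟩ = ⟨x, hx⟩ := by
    rw [OrderIso.symm_apply_eq]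
    rfl
  simp [this, h.invFunOn_apply hx]

theorem hasDerivWithinAt_invFunOn (h : IsGenerator I f f₁ f₂) {x : ℝ} (hx : x ∈ I) :
    HasDerivWithinAt (Function.invFunOn f I) (f₁ x)⁻¹ (f '' I) (f x) := by
  have hd : HasFDerivWithinAt f
      (ContinuousLinearEquiv.unitsEquivAut ℝ (Units.mk0 (f₁ x) (h.pos x hx).ne') : ℝ →L[ℝ] ℝ) I
      (Function.invFunOn f I (f x)) := by
    rw [h.invFunOn_apply hx]
    have he : ((ContinuousLinearEquiv.unitsEquivAut ℝ) (Units.mk0 (f₁ x) (h.pos x hx).ne') :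
        ℝ →L[ℝ] ℝ) = ContinuousLinearMap.toSpanSingleton ℝ (f₁ x) := by
      ext
      simp
    rw [he]
    exact (h.hasDeriv x hx).hasFDerivWithinAt
  have hmem : f x ∈ f '' I := ⟨x, hx, rfl⟩
  have := HasFDerivWithinAt.of_local_left_inverse (s := f '' I) (a := f x)
    (g := Function.invFunOn f I) ?_ hd hmem ?_
  · simpa using this.hasDerivWithinAt
  · refine tendsto_nhdsWithin_iff.2 ⟨h.continuousOn_invFunOn _ hmem, ?_⟩
    exact eventually_nhdsWithin_of_forall fun y hy => Function.invFunOn_mem hy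
  · exact eventually_nhdsWithin_of_forall fun y hy => Function.invFunOn_eq hy

/-! ### Concavity of the mean in its entries -/

/-- If `f'' < 0` and `f' / f''` is convex, then `-f'² / f''`, as a function of `f`, is concave. -/
theorem concaveOn_sq_div (h : IsGenerator I f f₁ f₂) (hneg : ∀ x ∈ I, f₂ x < 0)
    (hconv : ConvexOn ℝ I fun x => f₁ x / f₂ x) :
    ConcaveOn ℝ (f '' I) fun y => f₁ (Function.invFunOn f I y) ^ 2 /
      (-f₂ (Function.invFunOn f I y)) := by
  refine concaveOn_of_slope_anti_adjacent h.ordConnected_image.convex ?_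
  rintro _ y _ ⟨u, hu, rfl⟩ ⟨v, hv, rfl⟩ huy hyv
  obtain ⟨m, hm, rfl⟩ := h.ordConnected_image.out ⟨u, hu, rfl⟩ ⟨v, hv, rfl⟩ ⟨huy.le, hyv.le⟩
  simp only [h.invFunOn_apply hu, h.invFunOn_apply hv, h.invFunOn_apply hm]
  have hum : u < m := (h.strictMonoOn.lt_iff_lt hu hm).1 huy
  have hmv : m < v := (h.strictMonoOn.lt_iff_lt hm hv).1 hyv
  set g : ℝ → ℝ := fun x => f₁ x / (-f₂ x) with hg
  have hgpos : ∀ x ∈ I, 0 < g x := fun x hx => div_pos (h.pos x hx) (neg_pos.2 (hneg x hx))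
  have hgconc : ConcaveOn ℝ I g := by
    have : g = -fun x => f₁ x / f₂ x := by
      ext x
      simp [hg, div_neg]
    rw [this]
    exact hconv.neg
  have hH : ∀ x, f₁ x ^ 2 / (-f₂ x) = f₁ x * g x := by
    intro x
    simp only [hg]
    ring
  rw [hH, hH, hH]
  -- As `g` need not be differentiable, a chord slope `c` stands in for `g'`; the number `c - 1`
  -- will separate the two adjacent slopes.
  set c : ℝ := (g m - g u) / (m - u) with hc
  have hcmul : c * (m - u) = g m - g u := by
    rw [hc, div_mul_cancel₀ _ (sub_pos.2 hum).ne']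
  -- the chord of `g` through `u` and `m`
  set l : ℝ → ℝ := fun x => g m + c * (x - m) with hl
  have hlu : l u = g u := by
    simp only [hl]
    linarith
  have hlm : l m = g m := by simp [hl]
  have hle : ∀ x ∈ Set.Icc u m, l x ≤ g x := by
    rintro x ⟨hux, hxm⟩
    rcases hux.eq_or_lt with rfl | hux
    · exact hlu.le
    rcases hxm.eq_or_lt with rfl | hxm
    · exact hlm.le
    have h1 := hgconc.slope_anti_adjacent hu hm hux hxm
    rw [div_le_div_iff₀ (sub_pos.2 hxm) (sub_pos.2 hux)] at h1
    have h2 : c * (x - m) * (m - u) ≤ (g x - g m) * (m - u) := by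
      linear_combination h1 + (x - m) * hcmul
    have := le_of_mul_le_mul_right h2 (sub_pos.2 hum)
    simp only [hl]
    linarith
  have hge : ∀ x ∈ Set.Icc m v, g x ≤ l x := by
    rintro x ⟨hmx, hxv⟩
    rcases hmx.eq_or_lt with rfl | hmx
    · exact hlm.ge
    have hx : x ∈ I := h.ordConnected.out hm hv ⟨hmx.le, hxv⟩
    have h1 := hgconc.slope_anti_adjacent hu hx hum hmx
    rw [← hc, div_le_iff₀ (sub_pos.2 hmx)] at h1
    simp only [hl]
    linarith
  -- Since `f₂ = -f₁ / g`, the derivative of `K` is `f₁ * (1 - l / g)`. Hence `K` increases where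
  -- the chord lies below `g` and decreases where it lies above.
  set K : ℝ → ℝ := fun x => f₁ x * l x - (c - 1) * f x with hK
  have hKd : ∀ x ∈ I, HasDerivWithinAt K (f₁ x * (1 - l x / g x)) I x := by
    intro x hx
    have hld : HasDerivWithinAt l c I x := by
      have := (((hasDerivAt_id x).sub_const m).const_mul c).const_add (g m)
      rw [mul_one] at this
      exact this.hasDerivWithinAt
    have := ((h.hasDeriv₂ x hx).mul hld).sub ((h.hasDeriv x hx).const_mul (c - 1))
    have h2 := (hneg x hx).ne
    have h1 := (h.pos x hx).ne'
    refine this.congr_deriv ?_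
    simp only [hg]
    field_simp
    ring
  have hsub₁ : Set.Icc u m ⊆ I := h.ordConnected.out hu hm
  have hsub₂ : Set.Icc m v ⊆ I := h.ordConnected.out hm hv
  have hK₁ : K u ≤ K m := by
    refine monotoneOn_of_hasDerivWithinAt_nonneg (f' := fun x => f₁ x * (1 - l x / g x))
      (convex_Icc u m) (fun x hx => ((hKd x (hsub₁ hx)).mono hsub₁).continuousWithinAt)
      (fun x hx => (hKd x (hsub₁ (interior_subset hx))).mono (interior_subset.trans hsub₁)) ?_
      (Set.left_mem_Icc.2 hum.le) (Set.right_mem_Icc.2 hum.le) hum.le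
    intro x hx
    have hx' := interior_subset hx
    refine mul_nonneg (h.pos x (hsub₁ hx')).le (sub_nonneg.2 ?_)
    rw [div_le_one (hgpos x (hsub₁ hx'))]
    exact hle x hx'
  have hK₂ : K v ≤ K m := by
    refine antitoneOn_of_hasDerivWithinAt_nonpos (f' := fun x => f₁ x * (1 - l x / g x))
      (convex_Icc m v) (fun x hx => ((hKd x (hsub₂ hx)).mono hsub₂).continuousWithinAt)
      (fun x hx => (hKd x (hsub₂ (interior_subset hx))).mono (interior_subset.trans hsub₂)) ?_
      (Set.left_mem_Icc.2 hmv.le) (Set.right_mem_Icc.2 hmv.le) hmv.le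
    intro x hx
    have hx' := interior_subset hx
    refine mul_nonpos_of_nonneg_of_nonpos (h.pos x (hsub₂ hx')).le (sub_nonpos.2 ?_)
    rw [one_le_div (hgpos x (hsub₂ hx'))]
    exact hge x hx'
  have hlv : f₁ v * g v ≤ f₁ v * l v :=
    mul_le_mul_of_nonneg_left (hge v (Set.right_mem_Icc.2 hmv.le)) (h.pos v hv).le
  simp only [hK, hlu, hlm] at hK₁ hK₂
  refine le_trans (b := c - 1) ?_ ?_
  · rw [div_le_iff₀ (sub_pos.2 hyv)]
    linarith
  · rw [le_div_iff₀ (sub_pos.2 huy)]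
    linarith

section Means

variable {ι : Type*} {s : Finset ι} {w x y : ι → ℝ}

theorem average_mem (h : IsGenerator I f f₁ f₂) (hw : ∀ i ∈ s, 0 ≤ w i) (hs : 0 < ∑ i ∈ s, w i)
    (hx : ∀ i ∈ s, x i ∈ I) : (∑ i ∈ s, w i * f (x i)) / ∑ i ∈ s, w i ∈ f '' I := by
  have := h.ordConnected_image.convex.centerMass_mem hw hs (z := fun i => f (x i))
    fun i hi => ⟨x i, hx i hi, rfl⟩
  simpa [Finset.centerMass, div_eq_inv_mul] using this

theorem finsetMean_mem (h : IsGenerator I f f₁ f₂) (hw : ∀ i ∈ s, 0 ≤ w i)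
    (hs : 0 < ∑ i ∈ s, w i) (hx : ∀ i ∈ s, x i ∈ I) : finsetMean I f s w x ∈ I :=
  Function.invFunOn_mem (h.average_mem hw hs hx)

theorem apply_finsetMean (h : IsGenerator I f f₁ f₂) (hw : ∀ i ∈ s, 0 ≤ w i)
    (hs : 0 < ∑ i ∈ s, w i) (hx : ∀ i ∈ s, x i ∈ I) :
    f (finsetMean I f s w x) = (∑ i ∈ s, w i * f (x i)) / ∑ i ∈ s, w i :=
  Function.invFunOn_eq (h.average_mem hw hs hx)

/-- This is `N'' * f'(m)² ≤ f''(m) * N'²`, the condition for `f⁻¹ ∘ N` to have nonpositive second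
derivative at a point where its value is `m`. -/
theorem sum_second_deriv_mul_sq_le (h : IsGenerator I f f₁ f₂) (hw : ∀ i ∈ s, 0 ≤ w i)
    (hs : 0 < ∑ i ∈ s, w i) (hx : ∀ i ∈ s, x i ∈ I) (d : ι → ℝ) :
    (∑ i ∈ s, w i * (f₂ (x i) * d i ^ 2)) / (∑ i ∈ s, w i) * f₁ (finsetMean I f s w x) ^ 2 ≤
      f₂ (finsetMean I f s w x) * ((∑ i ∈ s, w i * (f₁ (x i) * d i)) / ∑ i ∈ s, w i) ^ 2 := by
  have hm := h.finsetMean_mem hw hs hx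
  rcases h.curvature with h0 | ⟨hneg, hconv⟩
  · rw [h0 _ hm, Finset.sum_eq_zero fun i hi => by rw [h0 _ (hx i hi)]; ring]
    simp
  · have hJ := (h.concaveOn_sq_div hneg hconv).le_map_centerMass hw hs (p := fun i => f (x i))
      fun i hi => ⟨x i, hx i hi, rfl⟩
    have hcm : s.centerMass w (fun i => f (x i)) =
        (∑ i ∈ s, w i * f (x i)) / ∑ i ∈ s, w i := by
      simp [Finset.centerMass, div_eq_inv_mul]
    rw [hcm, ← finsetMean] at hJ
    set m := finsetMean I f s w x
    set S := ∑ i ∈ s, w i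
    have hJ' : (∑ i ∈ s, w i * (f₁ (x i) ^ 2 / (-f₂ (x i)))) ≤ S * (f₁ m ^ 2 / (-f₂ m)) := by
      rw [Finset.centerMass, smul_eq_mul, inv_mul_le_iff₀ hs] at hJ
      refine le_trans (Finset.sum_le_sum fun i hi => ?_) hJ
      simp [h.invFunOn_apply (hx i hi)]
    have hnegp : ∀ i ∈ s, 0 < -f₂ (x i) := fun i hi => neg_pos.2 (hneg _ (hx i hi))
    -- Cauchy–Schwarz from the factorization `(f₁ d)² = (f₁² / (-f₂)) * (-f₂ d²)`; Jensen (`hJ'`)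
    -- bounds the first factor.
    have hCS : (∑ i ∈ s, w i * (f₁ (x i) * d i)) ^ 2 ≤
        (∑ i ∈ s, w i * (f₁ (x i) ^ 2 / (-f₂ (x i)))) *
          ∑ i ∈ s, w i * (-f₂ (x i) * d i ^ 2) := by
      refine Finset.sum_sq_le_sum_mul_sum_of_sq_le_mul s
        (fun i hi => mul_nonneg (hw i hi) (div_nonneg (sq_nonneg _) (hnegp i hi).le))
        (fun i hi => mul_nonneg (hw i hi) (mul_nonneg (hnegp i hi).le (sq_nonneg _))) ?_
      intro i hi
      have := (hneg _ (hx i hi)).ne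
      refine le_of_eq ?_
      field_simp
    have hT : ∑ i ∈ s, w i * (-f₂ (x i) * d i ^ 2) = -∑ i ∈ s, w i * (f₂ (x i) * d i ^ 2) := by
      rw [← Finset.sum_neg_distrib]
      exact Finset.sum_congr rfl fun i _ => by ring
    have hTnn : 0 ≤ ∑ i ∈ s, w i * (-f₂ (x i) * d i ^ 2) :=
      Finset.sum_nonneg fun i hi => mul_nonneg (hw i hi) (mul_nonneg (hnegp i hi).le (sq_nonneg _))
    rw [hT] at hCS hTnn
    set T := ∑ i ∈ s, w i * (f₂ (x i) * d i ^ 2)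
    set U := ∑ i ∈ s, w i * (f₁ (x i) * d i)
    have hU := hCS.trans (mul_le_mul_of_nonneg_right hJ' hTnn)
    have hn : 0 < -f₂ m := neg_pos.2 (hneg m hm)
    have hU' : U ^ 2 * (-f₂ m) ≤ S * f₁ m ^ 2 * -T := by
      have := mul_le_mul_of_nonneg_right hU hn.le
      refine this.trans_eq ?_
      have := (hneg m hm).ne
      field_simp
    rw [div_pow, div_mul_eq_mul_div, mul_div_assoc', div_le_div_iff₀ hs (by positivity)]
    nlinarith [mul_le_mul_of_nonneg_left hU' hs.le]

theorem concaveOn_finsetMean_segment (h : IsGenerator I f f₁ f₂) (hw : ∀ i ∈ s, 0 ≤ w i)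
    (hs : 0 < ∑ i ∈ s, w i) (hx : ∀ i ∈ s, x i ∈ I) (hy : ∀ i ∈ s, y i ∈ I) :
    ConcaveOn ℝ (Set.Icc 0 1) fun t : ℝ =>
      finsetMean I f s w fun i => x i + t * (y i - x i) := by
  set D : Set ℝ := Set.Icc 0 1
  set p : ℝ → ι → ℝ := fun t i => x i + t * (y i - x i) with hp
  have hpm : ∀ t ∈ D, ∀ i ∈ s, p t i ∈ I := by
    intro t ht i hi
    have := h.convex.add_smul_sub_mem (hx i hi) (hy i hi) ht
    simpa [hp] using this
  set d : ι → ℝ := fun i => y i - x i with hd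
  set S := ∑ i ∈ s, w i
  have hpd : ∀ i, ∀ t, HasDerivWithinAt (fun t => p t i) (d i) D t := by
    intro i t
    simpa [hp] using (((hasDerivAt_id t).mul_const (d i)).const_add (x i)).hasDerivWithinAt
  have hN : ∀ t ∈ D, HasDerivWithinAt (fun t => (∑ i ∈ s, w i * f (p t i)) / S)
      ((∑ i ∈ s, w i * (f₁ (p t i) * d i)) / S) D t := by
    intro t ht
    refine HasDerivWithinAt.div_const (HasDerivWithinAt.fun_sum fun i hi => ?_) S
    exact ((h.hasDeriv _ (hpm t ht i hi)).comp t (hpd i t)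
      fun t ht => hpm t ht i hi).const_mul (w i)
  have hN₁ : ∀ t ∈ D, HasDerivWithinAt (fun t => (∑ i ∈ s, w i * (f₁ (p t i) * d i)) / S)
      ((∑ i ∈ s, w i * (f₂ (p t i) * d i ^ 2)) / S) D t := by
    intro t ht
    refine HasDerivWithinAt.div_const (HasDerivWithinAt.fun_sum fun i hi => ?_) S
    have := (((h.hasDeriv₂ _ (hpm t ht i hi)).comp t (hpd i t)
      fun t ht => hpm t ht i hi).mul_const (d i)).const_mul (w i)
    exact this.congr_deriv (by ring)
  have hψm : ∀ t ∈ D, finsetMean I f s w (p t) ∈ I :=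
    fun t ht => h.finsetMean_mem hw hs (hpm t ht)
  have hψ : ∀ t ∈ D, HasDerivWithinAt (fun t => finsetMean I f s w (p t))
      ((f₁ (finsetMean I f s w (p t)))⁻¹ * ((∑ i ∈ s, w i * (f₁ (p t i) * d i)) / S)) D t := by
    intro t ht
    have h1 := h.hasDerivWithinAt_invFunOn (hψm t ht)
    rw [h.apply_finsetMean hw hs (hpm t ht)] at h1
    exact h1.comp t (hN t ht) fun t ht => h.average_mem hw hs (hpm t ht)
  have hψ₁ : ∀ t ∈ D, HasDerivWithinAt (fun t => f₁ (finsetMean I f s w (p t)))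
      (f₂ (finsetMean I f s w (p t)) *
        ((f₁ (finsetMean I f s w (p t)))⁻¹ * ((∑ i ∈ s, w i * (f₁ (p t i) * d i)) / S))) D t :=
    fun t ht => (h.hasDeriv₂ _ (hψm t ht)).comp t (hψ t ht) hψm
  refine concaveOn_of_hasDerivWithinAt2_nonpos (convex_Icc 0 1)
    (fun t ht => (hψ t ht).continuousWithinAt)
    (fun t ht => (hψ t (interior_subset ht)).mono interior_subset)
    (fun t ht => (((hψ₁ t (interior_subset ht)).fun_inv
      (h.pos _ (hψm t (interior_subset ht))).ne').mul
      (hN₁ t (interior_subset ht))).mono interior_subset) ?_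
  intro t ht
  have ht := interior_subset ht
  have hkey := h.sum_second_deriv_mul_sq_le hw hs (hpm t ht) d
  have hpos := h.pos _ (hψm t ht)
  change (∑ i ∈ s, w i * (f₂ (p t i) * d i ^ 2)) / S * f₁ (finsetMean I f s w (p t)) ^ 2 ≤
    f₂ (finsetMean I f s w (p t)) * ((∑ i ∈ s, w i * (f₁ (p t i) * d i)) / S) ^ 2 at hkey
  generalize (∑ i ∈ s, w i * (f₂ (p t i) * d i ^ 2)) / S = N₂ at *
  generalize (∑ i ∈ s, w i * (f₁ (p t i) * d i)) / S = N₁ at *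
  generalize finsetMean I f s w (p t) = m at *
  -- The left side is the derivative of `N' / f'(f⁻¹ ∘ N)`; the numerator on the right has the sign
  -- given by `hkey`.
  have : -(f₂ m * ((f₁ m)⁻¹ * N₁)) / f₁ m ^ 2 * N₁ + (f₁ m)⁻¹ * N₂ =
      (N₂ * f₁ m ^ 2 - f₂ m * N₁ ^ 2) / f₁ m ^ 3 := by
    field_simp
    ring
  rw [this]
  exact div_nonpos_of_nonpos_of_nonneg (by linarith) (by positivity)

/-- Concavity of the quasi-arithmetic mean in its entries. -/
theorem finsetMean_concave (h : IsGenerator I f f₁ f₂) (hw : ∀ i ∈ s, 0 ≤ w i)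
    (hs : 0 < ∑ i ∈ s, w i) (hx : ∀ i ∈ s, x i ∈ I) (hy : ∀ i ∈ s, y i ∈ I) {a b : ℝ}
    (ha : 0 ≤ a) (hb : 0 ≤ b) (hab : a + b = 1) :
    a * finsetMean I f s w x + b * finsetMean I f s w y ≤
      finsetMean I f s w fun i => a * x i + b * y i := by
  have := (h.concaveOn_finsetMean_segment hw hs hx hy).2 (Set.left_mem_Icc.2 zero_le_one)
    (Set.right_mem_Icc.2 zero_le_one) ha hb hab
  have hfun : (fun i => x i + b * (y i - x i)) = fun i => a * x i + b * y i := by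
    ext i
    rw [← eq_sub_iff_add_eq] at hab
    rw [hab]
    ring
  simpa [hfun] using this

end Means

end IsGenerator

/-! ### The axioms of a weighted mean, and the case of `WR` -/

theorem sum_shuffle {n : ℕ} (p q : Fin n → ℝ) :
    ∑ j, shuffle p q j = ∑ i, p i + ∑ i, q i := by
  have : ∑ j, shuffle p q j = ∑ z : Fin n × Fin 2, if z.2 = 0 then p z.1 else q z.1 := by
    -- The equivalence sends `(i, b)` to `b + 2 * i`, so `b` is the parity tested by `shuffle`.
    rw [← Equiv.sum_comp (finProdFinEquiv.trans (finCongr (mul_comm n 2)))]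
    refine Finset.sum_congr rfl ?_
    rintro ⟨i, b⟩ -
    fin_cases b
    · simp [shuffle]
    · have h1 : (1 + 2 * (i : ℕ)) % 2 = 1 := by omega
      have h2 : (1 + 2 * (i : ℕ)) / 2 = i := by omega
      simp [shuffle, h1, h2]
  rw [this, Fintype.sum_prod_type]
  simp [Fin.sum_univ_two, Finset.sum_add_distrib]

theorem shuffle_mul_comp_shuffle {n : ℕ} (f : ℝ → ℝ) (p q x : Fin n → ℝ) (j : Fin (2 * n)) :
    shuffle p q j * f (shuffle x x j) =
      shuffle (fun i => p i * f (x i)) (fun i => q i * f (x i)) j := by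
  unfold shuffle
  split_ifs <;> rfl

namespace IsGenerator

variable {I : Set ℝ} {f f₁ f₂ : ℝ → ℝ}

theorem isWeightedMean_quasiArith (h : IsGenerator I f f₁ f₂) :
    IsWeightedMean I (quasiArith I f) where
  maps_to n x lam hx hl := h.finsetMean_mem (fun i _ => hl.1 i) hl.2 fun i _ => hx i
  nullhomogeneous n x lam t hx hl ht := by
    simp only [quasiArith, Pi.smul_apply, smul_eq_mul, mul_assoc, ← Finset.mul_sum]
    rw [mul_div_mul_left _ _ ht.ne']
  reduction n x lam mu hx hl hm := by
    simp only [quasiArith, shuffle_mul_comp_shuffle, sum_shuffle, Pi.add_apply, add_mul,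
      Finset.sum_add_distrib]
  mean_value n x lam hx hl := by
    have hw : ∀ i ∈ Finset.univ, 0 ≤ lam i := fun i _ => hl.1 i
    have hxI : ∀ i ∈ Finset.univ, x i ∈ I := fun i _ => hx i
    have hmem := h.finsetMean_mem hw hl.2 hxI
    have happ := h.apply_finsetMean hw hl.2 hxI
    have : Nonempty (Fin n) := by
      by_contra hn
      rw [not_nonempty_iff] at hn
      simpa using hl.2
    change ⨅ i, x i ≤ finsetMean I f Finset.univ lam x ∧
      finsetMean I f Finset.univ lam x ≤ ⨆ i, x i
    constructor
    · obtain ⟨i₀, hi₀⟩ := Finite.exists_min x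
      refine (ciInf_le (Set.finite_range x).bddBelow i₀).trans ?_
      rw [← h.strictMonoOn.le_iff_le (hx i₀) hmem, happ, le_div_iff₀ hl.2, Finset.mul_sum]
      refine Finset.sum_le_sum fun i _ => ?_
      rw [mul_comm]
      exact mul_le_mul_of_nonneg_left
        ((h.strictMonoOn.le_iff_le (hx i₀) (hx i)).2 (hi₀ i)) (hl.1 i)
    · obtain ⟨i₀, hi₀⟩ := Finite.exists_max x
      refine le_trans ?_ (le_ciSup (Set.finite_range x).bddAbove i₀)
      rw [← h.strictMonoOn.le_iff_le hmem (hx i₀), happ, div_le_iff₀ hl.2, Finset.mul_sum]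
      refine Finset.sum_le_sum fun i _ => ?_
      rw [mul_comm (f (x i₀))]
      exact mul_le_mul_of_nonneg_left
        ((h.strictMonoOn.le_iff_le (hx i) (hx i₀)).2 (hi₀ i)) (hl.1 i)
  elimination n x lam j hx hl hj := by
    simp only [quasiArith]
    rw [Fin.sum_univ_succAbove _ j, Fin.sum_univ_succAbove lam j, hj]
    simp

theorem isSymmetric_quasiArith (I : Set ℝ) (f : ℝ → ℝ) : IsSymmetric I (quasiArith I f) := by
  intro n x lam σ _ _
  simp only [quasiArith, Function.comp_apply]
  rw [Equiv.sum_comp σ fun i => lam i * f (x i), Equiv.sum_comp σ lam]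

theorem isJensenConcave_quasiArith (h : IsGenerator I f f₁ f₂) :
    IsJensenConcave I (quasiArith I f) := by
  intro n x y lam hx hy hl
  have := h.finsetMean_concave (s := Finset.univ) (fun i _ => hl.1 i) hl.2 (fun i _ => hx i)
    (fun i _ => hy i) (a := 1 / 2) (b := 1 / 2) (by norm_num) (by norm_num) (by norm_num)
  have hmid : (fun i => (x i + y i) / 2) = fun i => 1 / 2 * x i + 1 / 2 * y i := by
    ext i
    ring
  rw [hmid]
  refine le_trans (le_of_eq ?_) this
  simp only [finsetMean, quasiArith]
  ring

theorem isContinuousInWeights_quasiArith (h : IsGenerator I f f₁ f₂) :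
    IsContinuousInWeights I (quasiArith I f) := by
  intro n x hx
  refine h.continuousOn_invFunOn.comp ?_ fun lam hl =>
    h.average_mem (fun i _ => hl.1 i) hl.2 fun i _ => hx i
  refine ContinuousOn.div (by fun_prop) (by fun_prop) fun lam hl => hl.2.ne'

theorem satisfiesKedlaya_of_mem_WR (h : IsGenerator I f f₁ f₂) {n : ℕ} {lam : Fin n → ℝ}
    (hl : lam ∈ WR I n) : SatisfiesKedlaya I (quasiArith I f) n lam :=
  hl.2 _ h.isWeightedMean_quasiArith (isSymmetric_quasiArith I f) h.isJensenConcave_quasiArith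
    h.isContinuousInWeights_quasiArith

end IsGenerator

/-! ### The mixed-mean inequality, by induction on the length -/

open Finset

theorem finsetMean_congr {ι : Type*} {I : Set ℝ} {f : ℝ → ℝ} {s : Finset ι} {w x y : ι → ℝ}
    (hxy : ∀ i ∈ s, x i = y i) : finsetMean I f s w x = finsetMean I f s w y := by
  unfold finsetMean
  rw [sum_congr rfl fun i hi => by rw [hxy i hi]]

theorem finsetMean_range_succ_of_eq_zero {I : Set ℝ} {f : ℝ → ℝ} {n : ℕ} {l x : ℕ → ℝ}
    (hl : l n = 0) : finsetMean I f (range (n + 1)) l x = finsetMean I f (range n) l x := by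
  simp [finsetMean, sum_range_succ, hl]

/-- For `j < N`, `F j` collects `l j - q * P j + q * P (j + 1) = (1 + q) * l j`, with `P j` the sum
of the first `j` weights. The truncated `j - 1` at `j = 0` is harmless because `P 0 = 0`. -/
theorem sum_range_succ_telescope (q : ℝ) (l F : ℕ → ℝ) (N : ℕ) :
    ∑ j ∈ range (N + 1), ((l j - q * ∑ i ∈ range j, l i) * F j +
        q * (∑ i ∈ range j, l i) * F (j - 1)) =
      (1 + q) * ∑ j ∈ range N, l j * F j + (l N - q * ∑ i ∈ range N, l i) * F N := by
  induction N with
  | zero => simp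
  | succ N ih =>
    rw [sum_range_succ, ih, sum_range_succ (fun j => l j * F j), sum_range_succ l]
    simp only [Nat.add_sub_cancel]
    ring

namespace IsGenerator

variable {I : Set ℝ} {f f₁ f₂ : ℝ → ℝ}

/-- One step of the mixed-mean inequality: `b j` lies between `a j` and `a (j - 1)`. -/
theorem finsetMean_range_le_of_between (h : IsGenerator I f f₁ f₂) {l a c : ℕ → ℝ} {n : ℕ}
    (hl : ∀ j ≤ n + 1, 0 < l j) (ha : ∀ j ≤ n + 1, a j ∈ I)
    (hc : ∀ j ≤ n + 1, l j * c j =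
      l (n + 1) / (∑ i ∈ range (n + 1), l i) * ∑ i ∈ range j, l i)
    (hc₀ : ∀ j ≤ n + 1, 0 ≤ c j) (hc₁ : ∀ j ≤ n + 1, c j ≤ 1) :
    finsetMean I f (range (n + 1)) l a ≤
      finsetMean I f (range (n + 2)) l fun j => (1 - c j) * a j + c j * a (j - 1) := by
  have hle : ∀ {m j : ℕ}, m ≤ n + 2 → j ∈ range m → j ≤ n + 1 := by
    intro m j hm hj
    rw [mem_range] at hj
    omega
  have hP₁ : 0 < ∑ i ∈ range (n + 1), l i :=
    sum_pos (fun i hi => hl i (hle (by omega) hi)) nonempty_range_add_one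
  have hP₂ : 0 < ∑ i ∈ range (n + 2), l i :=
    sum_pos (fun i hi => hl i (hle le_rfl hi)) nonempty_range_add_one
  have hbI : ∀ j ≤ n + 1, (1 - c j) * a j + c j * a (j - 1) ∈ I := fun j hj =>
    h.convex (ha j hj) (ha _ (by omega)) (sub_nonneg.2 (hc₁ j hj)) (hc₀ j hj) (by ring)
  have hm₁ := h.finsetMean_mem (s := range (n + 1)) (w := l) (x := a)
    (fun i hi => (hl i (hle (by omega) hi)).le) hP₁ fun i hi => ha i (hle (by omega) hi)
  have hm₂ := h.finsetMean_mem (s := range (n + 2)) (w := l)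
    (fun i hi => (hl i (hle le_rfl hi)).le) hP₂ fun i hi => hbI i (hle le_rfl hi)
  rw [← h.strictMonoOn.le_iff_le hm₁ hm₂,
    h.apply_finsetMean (fun i hi => (hl i (hle (by omega) hi)).le) hP₁
      fun i hi => ha i (hle (by omega) hi),
    h.apply_finsetMean (fun i hi => (hl i (hle le_rfl hi)).le) hP₂
      fun i hi => hbI i (hle le_rfl hi)]
  set q := l (n + 1) / ∑ i ∈ range (n + 1), l i with hq
  have hqP : q * ∑ i ∈ range (n + 1), l i = l (n + 1) := div_mul_cancel₀ _ hP₁.ne'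
  have hsum : ∑ i ∈ range (n + 2), l i = (1 + q) * ∑ i ∈ range (n + 1), l i := by
    rw [sum_range_succ, add_mul, hqP, one_mul]
  have hq0 : 0 < 1 + q := pos_of_mul_pos_left (hsum ▸ hP₂) hP₁.le
  have htel := sum_range_succ_telescope q l (fun j => f (a j)) (n + 1)
  -- The choice of `q` kills the last term of the telescoped sum.
  rw [hqP, sub_self, zero_mul, add_zero] at htel
  rw [← mul_div_mul_left _ _ hq0.ne', ← hsum, ← htel]
  refine div_le_div_of_nonneg_right (sum_le_sum fun j hj => ?_) hP₂.le
  have hj := hle le_rfl hj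
  rw [← hc j hj]
  have := h.concaveOn.2 (ha j hj) (ha (j - 1) (by omega)) (sub_nonneg.2 (hc₁ j hj)) (hc₀ j hj)
    (by ring)
  simp only [smul_eq_mul] at this
  refine le_trans (le_of_eq ?_) (mul_le_mul_of_nonneg_left this (hl j hj).le)
  ring

/-- The mixed-mean inequality for sequences. -/
theorem average_finsetMean_le (h : IsGenerator I f f₁ f₂) {l x : ℕ → ℝ} (hl₀ : 0 < l 0)
    (hl : ∀ i, 0 ≤ l i) (hanti : Antitone fun i => l i / ∑ j ∈ range (i + 1), l j)
    (hx : ∀ i, x i ∈ I) (n : ℕ) :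
    (∑ k ∈ range (n + 1), l k * finsetMean I f (range (k + 1)) l x) / ∑ k ∈ range (n + 1), l k ≤
      finsetMean I f (range (n + 1)) l fun k =>
        (∑ i ∈ range (k + 1), l i * x i) / ∑ i ∈ range (k + 1), l i := by
  have hP : ∀ k, 0 < ∑ i ∈ range (k + 1), l i := fun k =>
    sum_pos' (fun i _ => hl i) ⟨0, by simp, hl₀⟩
  set a : ℕ → ℝ := fun k => (∑ i ∈ range (k + 1), l i * x i) / ∑ i ∈ range (k + 1), l i with ha
  have haI : ∀ k, a k ∈ I := by
    intro k
    have := h.convex.centerMass_mem (t := range (k + 1)) (fun i _ => hl i) (hP k) fun i _ => hx i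
    simpa [Finset.centerMass, div_eq_inv_mul, ha] using this
  induction n with
  | zero =>
    have ha0 : a 0 = x 0 := by simp [ha, hl₀.ne']
    simp [finsetMean, hl₀.ne', ha0]
  | succ n ih =>
    rcases (hl (n + 1)).eq_or_lt with hn | hn
    · rw [finsetMean_range_succ_of_eq_zero hn.symm, sum_range_succ, sum_range_succ l, ← hn,
        zero_mul, add_zero, add_zero]
      exact ih
    -- A positive last weight forces all earlier ones to be positive, as the ratios are
    -- nonincreasing.
    have hlpos : ∀ j ≤ n + 1, 0 < l j := by
      intro j hj
      have h1 : 0 < l j / ∑ i ∈ range (j + 1), l i :=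
        (div_pos hn (hP (n + 1))).trans_le (hanti hj)
      exact (div_pos_iff_of_pos_right (hP j)).1 h1
    set q := l (n + 1) / ∑ i ∈ range (n + 1), l i with hq
    have hq0 : 0 < q := div_pos hn (hP n)
    have hP0 : ∀ j, 0 ≤ ∑ i ∈ range j, l i := fun j => sum_nonneg fun i _ => hl i
    -- This `c` is what solving `S * b j + l (n + 1) * x j = (S + l (n + 1)) * a j` for `b j`
    -- produces, with `S` the sum of the first `n + 1` weights.
    set c : ℕ → ℝ := fun j => q * (∑ i ∈ range j, l i) / l j with hc
    have hlc : ∀ j ≤ n + 1, l j * c j = q * ∑ i ∈ range j, l i := fun j hj =>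
      mul_div_cancel₀ _ (hlpos j hj).ne'
    have hc₀ : ∀ j ≤ n + 1, 0 ≤ c j := fun j hj =>
      div_nonneg (mul_nonneg hq0.le (hP0 j)) (hl j)
    -- Here the definition of `V` enters: after cross-multiplication, this is the comparison of the
    -- ratios at `j` and `n + 1`.
    have hc₁ : ∀ j ≤ n + 1, c j ≤ 1 := by
      intro j hj
      have h1 := hanti hj
      simp only at h1
      rw [div_le_div_iff₀ (hP _) (hP _), sum_range_succ l j, sum_range_succ l (n + 1)] at h1
      rw [hc]
      simp only
      rw [div_le_one (hlpos j hj), hq, div_mul_eq_mul_div, div_le_iff₀ (hP n)]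
      linarith
    have hstep := h.finsetMean_range_le_of_between hlpos (fun j _ => haI j) hlc hc₀ hc₁
    set b : ℕ → ℝ := fun j => (1 - c j) * a j + c j * a (j - 1) with hb
    have hbI : ∀ j ≤ n + 1, b j ∈ I := fun j hj =>
      h.convex (haI j) (haI _) (sub_nonneg.2 (hc₁ j hj)) (hc₀ j hj) (by ring)
    have hsum : ∑ i ∈ range (n + 1 + 1), l i = (∑ i ∈ range (n + 1), l i) + l (n + 1) :=
      sum_range_succ _ _
    have hcomb : ∀ j ∈ range (n + 1 + 1),
        (∑ i ∈ range (n + 1), l i) / (∑ i ∈ range (n + 1 + 1), l i) * b j +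
          l (n + 1) / (∑ i ∈ range (n + 1 + 1), l i) * x j = a j := by
      intro j hj
      have hj : j ≤ n + 1 := by
        rw [mem_range] at hj
        omega
      have hS := hP n
      have hSl : 0 < (∑ i ∈ range (n + 1), l i) + l (n + 1) := add_pos hS hn
      rw [hsum, div_mul_eq_mul_div, div_mul_eq_mul_div, ← add_div, div_eq_iff hSl.ne']
      cases j with
      | zero =>
        have ha0 : a 0 = x 0 := by simp [ha, hl₀.ne']
        simp only [hb, hc, range_zero, sum_empty, ha0]
        ring
      | succ j =>
        have hlj := hlpos _ hj
        have hA : a (j + 1) * ((∑ i ∈ range (j + 1), l i) + l (j + 1)) =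
            a j * (∑ i ∈ range (j + 1), l i) + l (j + 1) * x (j + 1) := by
          simp only [ha]
          rw [div_mul_cancel₀ _ (hP j).ne', ← sum_range_succ, div_mul_cancel₀ _ (hP (j + 1)).ne',
            sum_range_succ]
        have hqS : q * ∑ i ∈ range (n + 1), l i = l (n + 1) := div_mul_cancel₀ _ hS.ne'
        have hlc' := hlc _ hj
        simp only [hb, Nat.add_sub_cancel]
        rw [← mul_right_inj' hlj.ne', ← hqS]
        generalize ∑ i ∈ range (n + 1), l i = S at *
        generalize ∑ i ∈ range (j + 1), l i = P at *
        linear_combination (-q * S) * hA + S * (a j - a (j + 1)) * hlc'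
    have hconc := h.finsetMean_concave (s := range (n + 1 + 1)) (w := l) (x := b) (y := x)
      (fun i _ => hl i) (hP (n + 1)) (fun i hi => hbI i (by rw [mem_range] at hi; omega))
      (fun i _ => hx i) (div_nonneg (hP0 (n + 1)) (hP0 _)) (div_nonneg hn.le (hP0 _))
      (by rw [← add_div, ← hsum, div_self (hP (n + 1)).ne'])
    rw [finsetMean_congr hcomb] at hconc
    refine le_trans ?_ hconc
    -- The induction hypothesis and the telescoping step bound the mean of `b`; the mean of `x` is
    -- the new summand on the left.
    have hlast := ih.trans hstep
    rw [div_le_iff₀ (hP n)] at hlast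
    rw [sum_range_succ, div_mul_eq_mul_div, div_mul_eq_mul_div, ← add_div]
    refine div_le_div_of_nonneg_right ?_ (hP _).le
    linarith

end IsGenerator

/-! ### Transfer to finite vectors, and the case of `V` -/

theorem quasiArith_eq_finsetMean_range {I : Set ℝ} {f : ℝ → ℝ} {n : ℕ} {x lam : Fin n → ℝ}
    {l X : ℕ → ℝ} (hx : ∀ i, x i = X i) (hl : ∀ i, lam i = l i) :
    quasiArith I f n x lam = finsetMean I f (range n) l X := by
  simp [quasiArith, finsetMean, sum_range, hx, hl]

theorem arith_eq_sum_range_div {n : ℕ} {x lam : Fin n → ℝ}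
    {l X : ℕ → ℝ} (hx : ∀ i, x i = X i) (hl : ∀ i, lam i = l i) :
    arith n x lam = (∑ i ∈ range n, l i * X i) / ∑ i ∈ range n, l i := by
  simp [arith, sum_range, hx, hl]

theorem IsGenerator.satisfiesKedlaya_of_mem_V {I : Set ℝ} {f f₁ f₂ : ℝ → ℝ}
    (h : IsGenerator I f f₁ f₂) {n : ℕ} {lam : Fin n → ℝ} (hlam : lam ∈ V n) :
    SatisfiesKedlaya I (quasiArith I f) n lam := by
  intro x hx
  obtain ⟨⟨hnn, hn, h0⟩, hanti⟩ := hlam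
  obtain ⟨n, rfl⟩ := Nat.exists_eq_add_one_of_ne_zero hn.ne'
  -- Padding the weights by zero keeps the ratios nonincreasing; padding the entries by `x 0` keeps
  -- them in `I`.
  set l : ℕ → ℝ := fun i => if hi : i < n + 1 then lam ⟨i, hi⟩ else 0 with hl
  set X : ℕ → ℝ := fun i => if hi : i < n + 1 then x ⟨i, hi⟩ else x 0 with hX
  have hlv : ∀ i : Fin (n + 1), lam i = l i := fun i => by simp only [hl, i.2, dif_pos]
  have hXv : ∀ i : Fin (n + 1), x i = X i := fun i => by simp only [hX, i.2, dif_pos]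
  have hl' : ∀ i, 0 ≤ l i := by
    intro i
    simp only [hl]
    split_ifs
    exacts [hnn _, le_rfl]
  have hX' : ∀ i, X i ∈ I := by
    intro i
    simp only [hX]
    split_ifs <;> exact hx _
  have hIic : ∀ i : Fin (n + 1), ∑ j ∈ Iic i, lam j = ∑ j ∈ range ((i : ℕ) + 1), l j := by
    intro i
    rw [Nat.range_succ_eq_Iic, ← Fin.map_valEmbedding_Iic, sum_map]
    exact sum_congr rfl fun j _ => hlv j
  have hanti' : Antitone fun i => l i / ∑ j ∈ range (i + 1), l j := by
    intro i j hij
    by_cases hj : j < n + 1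
    · have := @hanti ⟨i, by omega⟩ ⟨j, hj⟩ hij
      simp only [hIic] at this
      simpa only [hlv] using this
    · have : l j = 0 := dif_neg hj
      simp only [this, zero_div]
      exact div_nonneg (hl' i) (sum_nonneg fun _ _ => hl' _)
  have key := h.average_finsetMean_le (by simpa [hl] using h0) hl' hanti' hX' n
  have hX₀ : ∀ (k : Fin (n + 1)) i, initial x k i = X i := fun k i => hXv (Fin.castLE k.isLt i)
  have hl₀ : ∀ (k : Fin (n + 1)) i, initial lam k i = l i := fun k i => hlv (Fin.castLE k.isLt i)
  rw [arith_eq_sum_range_div (l := l) (X := fun k => finsetMean I f (range (k + 1)) l X)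
      (fun k => quasiArith_eq_finsetMean_range (hX₀ k) (hl₀ k)) hlv,
    quasiArith_eq_finsetMean_range (l := l)
      (X := fun k => (∑ i ∈ range (k + 1), l i * X i) / ∑ i ∈ range (k + 1), l i)
      (fun k => arith_eq_sum_range_div (hX₀ k) (hl₀ k)) hlv]
  exact key

/-! ### Normalizing the sign of the derivative -/

theorem quasiArith_neg (I : Set ℝ) (f : ℝ → ℝ) : quasiArith I (-f) = quasiArith I f := by
  funext n x lam
  have hsum : (∑ i, lam i * (-f) (x i)) / ∑ i, lam i = -((∑ i, lam i * f (x i)) / ∑ i, lam i) := by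
    simp only [Pi.neg_apply, mul_neg, sum_neg_distrib, neg_div]
  -- `Function.invFunOn` chooses from this predicate, so equal predicates give equal values even off
  -- the image of `f`.
  have hpred : ∀ y, (fun a => a ∈ I ∧ (-f) a = -y) = fun a => a ∈ I ∧ f a = y := by
    intro y
    ext a
    simp
  unfold quasiArith
  rw [hsum]
  unfold Function.invFunOn
  rw [hpred]

/-- Up to its sign, a function as in the theorem is a generator. -/
theorem exists_isGenerator {I : Set ℝ} (hI : I.OrdConnected) {f : ℝ → ℝ}
    (hf : ContDiffOn ℝ 2 f I) (hf' : ∀ x ∈ I, derivWithin f I x ≠ 0)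
    (hf'' : (∀ x ∈ I, derivWithin (derivWithin f I) I x = 0) ∨
      ((∀ x ∈ I, derivWithin (derivWithin f I) I x ≠ 0) ∧
        ConvexOn ℝ I (fun x => derivWithin f I x / derivWithin (derivWithin f I) I x) ∧
        ∀ x ∈ I, derivWithin f I x / derivWithin (derivWithin f I) I x < 0)) :
    ∃ F F₁ F₂, IsGenerator I F F₁ F₂ ∧ quasiArith I F = quasiArith I f := by
  -- `derivWithin` defaults to zero where derivatives are not unique, so `f' ≠ 0` rules out a
  -- one-point interval.
  have hu : UniqueDiffOn ℝ I := fun x hx => by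
    by_contra hc
    exact hf' x hx (derivWithin_zero_of_not_uniqueDiffWithinAt hc)
  have hd₁ : ∀ x ∈ I, HasDerivWithinAt f (derivWithin f I x) I x := fun x hx =>
    (hf.differentiableOn (by norm_num) x hx).hasDerivWithinAt
  have hf₁ : ContDiffOn ℝ 1 (derivWithin f I) I := hf.derivWithin hu (by norm_num)
  have hd₂ : ∀ x ∈ I, HasDerivWithinAt (derivWithin f I)
      (derivWithin (derivWithin f I) I x) I x := fun x hx =>
    (hf₁.differentiableOn (by norm_num) x hx).hasDerivWithinAt
  set f₁ := derivWithin f I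
  set f₂ := derivWithin f₁ I
  by_cases hpos : ∀ x ∈ I, 0 < f₁ x
  · refine ⟨f, f₁, f₂, ⟨hI, hd₁, hd₂, hpos, hf''.imp_right ?_⟩, rfl⟩
    rintro ⟨-, hconv, hneg⟩
    exact ⟨fun x hx => (div_neg_iff.1 (hneg x hx)).elim (·.2)
      fun hc => absurd (hpos x hx) hc.1.not_gt, hconv⟩
  · push Not at hpos
    obtain ⟨a, ha, ha₀⟩ := hpos
    -- A continuous nonvanishing derivative on an interval has constant sign.
    have hneg₁ : ∀ x ∈ I, f₁ x < 0 := by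
      intro x hx
      by_contra! hc
      obtain ⟨y, hy, hy₀⟩ :=
        hI.isPreconnected.intermediate_value ha hx hf₁.continuousOn ⟨ha₀, hc⟩
      exact hf' y hy hy₀
    refine ⟨-f, -f₁, -f₂, ⟨hI, fun x hx => (hd₁ x hx).neg, fun x hx => (hd₂ x hx).neg,
      fun x hx => neg_pos.2 (hneg₁ x hx), ?_⟩, quasiArith_neg I f⟩
    refine hf''.imp (fun h0 x hx => neg_eq_zero.2 (h0 x hx)) ?_
    rintro ⟨-, hconv, hneg⟩
    refine ⟨fun x hx => neg_neg_iff_pos.2 ?_, ?_⟩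
    · exact (div_neg_iff.1 (hneg x hx)).elim
        (fun hc => absurd (hneg₁ x hx) hc.1.not_gt) (·.2)
    · simpa only [Pi.neg_apply, neg_div_neg_eq] using hconv

end Kedlaya

theorem proposition4p6 (I : Set ℝ) (hI : I.OrdConnected) (f : ℝ → ℝ)
    (hf : ContDiffOn ℝ 2 f I)
    (hf' : ∀ x ∈ I, derivWithin f I x ≠ 0)
    (hf'' : (∀ x ∈ I, derivWithin (derivWithin f I) I x = 0) ∨
      ((∀ x ∈ I, derivWithin (derivWithin f I) I x ≠ 0) ∧
        ConvexOn ℝ I (fun x => derivWithin f I x / derivWithin (derivWithin f I) I x) ∧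
        ∀ x ∈ I, derivWithin f I x / derivWithin (derivWithin f I) I x < 0)) :
    (∀ n : ℕ, ∀ lam ∈ Kedlaya.WR I n,
      Kedlaya.SatisfiesKedlaya I (Kedlaya.quasiArith I f) n lam) ∧
    (∀ n : ℕ, ∀ lam ∈ Kedlaya.V n,
      Kedlaya.SatisfiesKedlaya I (Kedlaya.quasiArith I f) n lam) := by
  obtain ⟨F, F₁, F₂, hF, hFf⟩ := Kedlaya.exists_isGenerator hI hf hf' hf''
  rw [← hFf]
  exact ⟨fun n lam hlam => hF.satisfiesKedlaya_of_mem_WR hlam,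
    fun n lam hlam => hF.satisfiesKedlaya_of_mem_V hlam⟩
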